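/- Let $\mathbb K=\mathbb R$ or $\mathbb C$, let $m\ge 1$, and let $E_1,\dots,E_m,F$ be infinite-dimensional Banach spaces over $\mathbb K$. For $p,q>0$, the multilinear $m$-index of $(p,q)$-summability $\eta_{(p,q)}^{m\text{-}mult}(E_1,\dots,E_m;F)$ is the infimum (equal to $+\infty$ if there are none) of all $\sigma\ge 0$ such that for every continuous $m$-linear operator $T:E_1\times\cdots\times E_m\to F$ there is a constant $C\ge 0$ with $$\Big(\sum_{k_1,\dots,k_m=1}^{n}\big\|T(x^{(1)}_{k_1},\dots,x^{(m)}_{k_m})\big\|^p\Big)^{1/p}\le C\,n^{\sigma}\prod_{i=1}^m\Big(\sup_{\varphi\in B_{E_i^*}}\sum_{k=1}^n|\varphi(x^{(i)}_k)|^q\Big)^{1/q}$$ for all positive integers $n$ and all $x^{(i)}_k\in E_i$ ($1\le k\le n$, $1\le i\le m$), where $B_{E_i^*}$ is the closed unit ball of the dual of $E_i$. For $2\le q\le\infty$, $F$ has cotype $q$ if there is $C\ge0$ such that $\big(\sum_{k=1}^n\|x_k\|^q\big)^{1/q}\le C\big(\int_0^1\|\sum_{k=1}^n r_k(\tau)x_k\|^2\,d\tau\big)^{1/2}$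 for all finite families $x_1,\dots,x_n\in F$ (with $\max_k\|x_k\|$ on the left if $q=\infty$), where $r_k(\tau)=\operatorname{sign}(\sin(2^k\pi\tau))$; put $\cot(F)=\inf\{q\in[2,\infty]: F\text{ has cotype }q\}$. Suppose that $\cot(F)=r<\infty$, that $1\le s<2$, that $m<\frac{s}{r(s-1)}$ (no restriction if $s=1$), and let $t=\frac{sr}{s-msr+mr}$. Then: (a) if $0<p\le t$ and $\frac{mrt}{r-t+mrt}\le q$, then $$\eta_{(p,q)}^{m\text{-}mult}(E_1,\dots,E_m;F)\le\frac mp+m-\frac1r-\frac mq-\frac{m-1}{t};$$ (b) if $0<p\le t$ and $0<q\le\frac{mrt}{r-t+mrt}$, then $$\eta_{(p,q)}^{m\text{-}mult}(E_1,\dots,E_m;F)\le\frac mp-\frac mt;$$ (c) if $0<t\le p$ and $\frac{mrt}{r-t+mrt}\le q$, then $$\eta_{(p,q)}^{m\text{-}mult}(E_1,\dots,E_m;F)\le m-\frac1r+\frac1t-\frac mq;$$ (d) if $0<t\le p$ and $0<q\le\frac{mrt}{r-t+mrt}$, then $$\eta_{(p,q)}^{m\text{-}mult}(E_1,\dots,E_m;F)=0.$$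 -/

import Mathlib

open scoped ENNReal

noncomputable section

namespace MultIndex

/-- The `k`-th Rademacher function `r_k(t) = sign (sin (2 ^ k * π * t))`, for `k = 1, 2, …`. -/
def rademacher (k : ℕ) (t : ℝ) : ℝ :=
  Real.sign (Real.sin ((2 : ℝ) ^ k * Real.pi * t))

/-- `F` has cotype `q`, where `2 ≤ q ≤ ∞`.  The left-hand side is the `ℓ_q^n(F)` norm of the vectors
`x_1, …, x_n`: it is `(∑ ‖x_k‖ ^ q) ^ (1 / q)` for finite `q` and `max ‖x_k‖` for `q = ∞`.
The vectors are indexed by `Fin n`, which starts at `0`, hence the shift by one. -/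
def HasCotype (𝕜 : Type*) [RCLike 𝕜] (F : Type*) [NormedAddCommGroup F] [NormedSpace 𝕜 F]
    (q : ℝ≥0∞) : Prop :=
  2 ≤ q ∧ ∃ C : ℝ, 0 ≤ C ∧ ∀ (n : ℕ) (x : Fin n → F),
    ‖(WithLp.toLp q x : PiLp q (fun _ : Fin n => F))‖ ≤
      C * (∫ t in (0 : ℝ)..1,
        ‖∑ k : Fin n, ((rademacher ((k : ℕ) + 1) t : ℝ) : 𝕜) • x k‖ ^ 2) ^ (1 / 2 : ℝ)

/-- `cot F = inf {q ∈ [2, ∞] : F has cotype q}`. -/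
def cot (𝕜 : Type*) [RCLike 𝕜] (F : Type*) [NormedAddCommGroup F] [NormedSpace 𝕜 F] : ℝ≥0∞ :=
  sInf {q : ℝ≥0∞ | HasCotype 𝕜 F q}

/-- The weak `ℓ_q` norm `(sup_{φ ∈ B_{E*}} ∑ |φ (x_k)| ^ q) ^ (1 / q)` of a finite sequence. -/
def weakNorm (𝕜 : Type*) [RCLike 𝕜] {E : Type*} [NormedAddCommGroup E] [NormedSpace 𝕜 E]
    (q : ℝ) {n : ℕ} (x : Fin n → E) : ℝ :=
  (⨆ φ : Metric.closedBall (0 : StrongDual 𝕜 E) 1,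
    ∑ k : Fin n, ‖(φ : StrongDual 𝕜 E) (x k)‖ ^ q) ^ (1 / q)

/-- The exponents `σ ≥ 0` for which every continuous `m`-linear `T : E_1 × ⋯ × E_m → F` satisfies
the multiple `(p, q)`-summing inequality up to a factor `C * n ^ σ`, where `C` does not depend on
`n` or on the vectors.  (`C` depends on `T`, as both sides of the inequality would otherwise have
to be compared for all scalar multiples of `T` at once.) -/
def admissibleExponents (𝕜 : Type*) [RCLike 𝕜] {m : ℕ} (E : Fin m → Type*)
    [∀ i, NormedAddCommGroup (E i)] [∀ i, NormedSpace 𝕜 (E i)]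
    (F : Type*) [NormedAddCommGroup F] [NormedSpace 𝕜 F] (p q : ℝ) : Set ℝ :=
  {σ : ℝ | 0 ≤ σ ∧ ∀ T : ContinuousMultilinearMap 𝕜 E F, ∃ C : ℝ, 0 ≤ C ∧
    ∀ n : ℕ, 1 ≤ n → ∀ x : (i : Fin m) → Fin n → E i,
      (∑ k : Fin m → Fin n, ‖T (fun i => x i (k i))‖ ^ p) ^ (1 / p) ≤
        C * (n : ℝ) ^ σ * ∏ i, weakNorm 𝕜 q (x i)}

/-- The multilinear `m`-index of `(p, q)`-summability of `(E_1 × ⋯ × E_m, F)`, the infimum of the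
admissible exponents.  It is taken in the extended reals, so that it is `+∞` (and not `0`) when
there is no admissible exponent. -/
def multIndex (𝕜 : Type*) [RCLike 𝕜] {m : ℕ} (E : Fin m → Type*)
    [∀ i, NormedAddCommGroup (E i)] [∀ i, NormedSpace 𝕜 (E i)]
    (F : Type*) [NormedAddCommGroup F] [NormedSpace 𝕜 F] (p q : ℝ) : EReal :=
  sInf ((fun σ : ℝ => (σ : EReal)) '' admissibleExponents 𝕜 E F p q)

end MultIndex

end

/-! All four bounds come from one coincidence theorem: if `F` has cotype `r` and `1 / t = 1 / r - m
* (1 - 1 / s) > 0`, then every continuous `m`-linear `T` into `F` is multiple `(t, s)`-summing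
(`HasCotype.exists_multiple_summing`). Passing from `ℓ_t` to `ℓ_p` over `n ^ m` terms, and from weak
`ℓ_s` to weak `ℓ_q` in each of the `m` variables, then costs `n` to the power `m * max 0 (1 / p - 1
/ t) + m * max 0 (1 / s - 1 / q)`. The threshold for `q` in the statement equals `s`, so (a)-(d) are
the four sign patterns of the two maxima.

For `s = 1` the coincidence theorem is cotype applied one index at a time. For `s > 1`, put `v k = T
(x k)`, `S = ∑ ‖v k‖ ^ t`, and weight the `j`-th vector of the `i`-th variable by its marginal of
`‖v k‖ ^ t`, raised to `e = 1 - 1 / s`. Hölder and iterated cotype bound the weighted `ℓ_r` sum by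
`(c * S ^ (e * m) * W) ^ r`, with `W` the product of the weak `ℓ_s` norms, while the weights make
that sum at least `S`. Dividing by `S ^ (e * m)` leaves `S ^ (1 / t) ≤ c * W`.

The infimum `cot F` need not be attained, so this is used for cotypes `r' ≥ r` near `r`, and
continuity in `r'` gives the bound at `r`. -/

open Filter Topology MeasureTheory

namespace MultIndex

/-! ### Inequalities for finite sums -/

section Sums

variable {ι : Type*} [Fintype ι]

/-- Comparison of the `ℓ_p` and `ℓ_t` norms of a finite family, for arbitrary `p, t > 0`. -/
theorem rpow_sum_rpow_le {a : ι → ℝ} (ha : ∀ i, 0 ≤ a i) {p t : ℝ} (hp : 0 < p) (ht : 0 < t) :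
    (∑ i, a i ^ p) ^ (1 / p) ≤
      (Fintype.card ι : ℝ) ^ max 0 (1 / p - 1 / t) * (∑ i, a i ^ t) ^ (1 / t) := by
  have hpos : ∀ u : ℝ, 0 ≤ ∑ i, a i ^ u := fun u =>
    Finset.sum_nonneg fun i _ => Real.rpow_nonneg (ha i) u
  rcases le_total p t with hpt | htp
  · have h1 : 1 / t ≤ 1 / p := one_div_le_one_div_of_le hp hpt
    rw [max_eq_right (by linarith)]
    -- Power mean inequality with exponent `t / p ≥ 1`; its constant `card ^ (t / p - 1)` becomes
    -- `card ^ (1 / p - 1 / t)` after the `t`-th root.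
    have h := Real.rpow_sum_le_const_mul_sum_rpow (s := Finset.univ) (fun i => a i ^ p)
      ((one_le_div hp).2 hpt)
    have e : ∀ i, |a i ^ p| = a i ^ p := fun i => abs_of_nonneg (Real.rpow_nonneg (ha i) p)
    have e' : ∀ i, (a i ^ p) ^ (t / p) = a i ^ t := fun i => by
      rw [← Real.rpow_mul (ha i)]; congr 1; field_simp
    simp only [e, e', Finset.card_univ] at h
    have h2 := Real.rpow_le_rpow (Real.rpow_nonneg (hpos p) _) h (one_div_pos.2 ht).le
    rw [← Real.rpow_mul (hpos p), Real.mul_rpow (by positivity) (hpos t),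
      ← Real.rpow_mul (by positivity)] at h2
    convert h2 using 2 <;> (try congr 1) <;> field_simp
  · have h1 : 1 / p ≤ 1 / t := one_div_le_one_div_of_le ht htp
    rw [max_eq_left (by linarith), Real.rpow_zero, one_mul]
    set S := ∑ i, a i ^ t with hS
    have hi : ∀ i, a i ≤ S ^ (1 / t) := fun i => by
      have : a i ^ t ≤ S := Finset.single_le_sum (f := fun i => a i ^ t)
        (fun i _ => Real.rpow_nonneg (ha i) t) (Finset.mem_univ i)
      calc a i = (a i ^ t) ^ (1 / t) := by
            rw [← Real.rpow_mul (ha i), mul_one_div_cancel ht.ne', Real.rpow_one]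
        _ ≤ _ := Real.rpow_le_rpow (Real.rpow_nonneg (ha i) t) this (one_div_pos.2 ht).le
    have hS0 : 0 ≤ S := hpos t
    have hle : ∑ i, a i ^ p ≤ S ^ (p / t) := by
      calc ∑ i, a i ^ p ≤ ∑ i, a i ^ t * (S ^ (1 / t)) ^ (p - t) := by
            refine Finset.sum_le_sum fun i _ => ?_
            have : a i ^ p = a i ^ t * a i ^ (p - t) := by
              rw [← Real.rpow_add_of_nonneg (ha i) ht.le (by linarith)]; congr 1; ring
            rw [this]
            exact mul_le_mul_of_nonneg_left (Real.rpow_le_rpow (ha i) (hi i) (by linarith))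
              (Real.rpow_nonneg (ha i) t)
        _ = S ^ (1 : ℝ) * S ^ ((p - t) / t) := by
            rw [← Finset.sum_mul, ← Real.rpow_mul hS0, ← hS, Real.rpow_one]; congr 2; ring
        _ = S ^ (p / t) := by
            rw [← Real.rpow_add_of_nonneg hS0 zero_le_one (div_nonneg (by linarith) ht.le)]
            congr 1; field_simp; ring
    calc (∑ i, a i ^ p) ^ (1 / p) ≤ (S ^ (p / t)) ^ (1 / p) :=
          Real.rpow_le_rpow (hpos p) hle (one_div_pos.2 hp).le
      _ = S ^ (1 / t) := by rw [← Real.rpow_mul hS0]; congr 1; field_simp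

/-- Hölder's inequality with the exponents `1 / (1 - 1 / s)` and `s`, including `s = 1`. -/
theorem sum_rpow_mul_le {R b : ι → ℝ} (hR : ∀ i, 0 ≤ R i) (hb : ∀ i, 0 ≤ b i) {s : ℝ}
    (hs : 1 ≤ s) :
    ∑ i, R i ^ (1 - 1 / s) * b i ≤ (∑ i, R i) ^ (1 - 1 / s) * (∑ i, b i ^ s) ^ (1 / s) := by
  rcases hs.eq_or_lt with rfl | hs
  -- Here the exponent of `R i` is `0`, and `0 ^ 0 = 1` covers vanishing `R i`.
  · simp
  have hs0 : 0 < s := by linarith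
  have h1 : 1 / s < 1 := by rw [div_lt_one hs0]; exact hs
  have he : 0 < 1 - 1 / s := by linarith
  have hc : (1 / (1 - 1 / s)).HolderConjugate s := by
    rw [Real.holderConjugate_iff]
    refine ⟨(one_lt_div he).2 (by linarith [one_div_pos.2 hs0]), ?_⟩
    simp
  have h := Real.inner_le_Lp_mul_Lq_of_nonneg Finset.univ hc
    (f := fun i => R i ^ (1 - 1 / s)) (g := b)
    (fun i _ => Real.rpow_nonneg (hR i) _) (fun i _ => hb i)
  have e : ∀ i, (R i ^ (1 - 1 / s)) ^ (1 / (1 - 1 / s)) = R i := fun i => by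
    rw [← Real.rpow_mul (hR i), mul_one_div_cancel he.ne', Real.rpow_one]
  simpa only [e, one_div_one_div] using h

end Sums

/-! ### Weak `ℓ_q` norms -/

section WeakNorm

variable {𝕜 : Type*} [RCLike 𝕜] {E : Type*} [NormedAddCommGroup E] [NormedSpace 𝕜 E]

theorem weakNorm_nonneg (q : ℝ) {n : ℕ} (x : Fin n → E) : 0 ≤ weakNorm 𝕜 q x :=
  Real.rpow_nonneg (Real.iSup_nonneg fun _ => Finset.sum_nonneg fun _ _ =>
    Real.rpow_nonneg (norm_nonneg _) _) _

theorem le_weakNorm {q : ℝ} (hq : 0 < q) {n : ℕ} (x : Fin n → E) {φ : StrongDual 𝕜 E}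
    (hφ : ‖φ‖ ≤ 1) : (∑ k, ‖φ (x k)‖ ^ q) ^ (1 / q) ≤ weakNorm 𝕜 q x := by
  refine Real.rpow_le_rpow (Finset.sum_nonneg fun _ _ => Real.rpow_nonneg (norm_nonneg _) _) ?_
    (one_div_pos.2 hq).le
  refine le_ciSup (f := fun φ : Metric.closedBall (0 : StrongDual 𝕜 E) 1 =>
    ∑ k, ‖(φ : StrongDual 𝕜 E) (x k)‖ ^ q) ?_ ⟨φ, by simpa using hφ⟩
  -- An unbounded real supremum would be `0` by convention, so an explicit upper bound is needed.
  refine ⟨∑ k, ‖x k‖ ^ q, ?_⟩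
  rintro _ ⟨ψ, rfl⟩
  refine Finset.sum_le_sum fun k _ => Real.rpow_le_rpow (norm_nonneg _) ?_ hq.le
  have hψ : ‖(ψ : StrongDual 𝕜 E)‖ ≤ 1 := mem_closedBall_zero_iff.1 ψ.2
  simpa using (ψ : StrongDual 𝕜 E).le_of_opNorm_le hψ (x k)

theorem weakNorm_le {q : ℝ} (hq : 0 < q) {n : ℕ} {x : Fin n → E} {B : ℝ} (hB : 0 ≤ B)
    (h : ∀ φ : StrongDual 𝕜 E, ‖φ‖ ≤ 1 → (∑ k, ‖φ (x k)‖ ^ q) ^ (1 / q) ≤ B) :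
    weakNorm 𝕜 q x ≤ B := by
  have hnn : ∀ φ : StrongDual 𝕜 E, 0 ≤ ∑ k, ‖φ (x k)‖ ^ q := fun φ =>
    Finset.sum_nonneg fun _ _ => Real.rpow_nonneg (norm_nonneg _) _
  have : (⨆ φ : Metric.closedBall (0 : StrongDual 𝕜 E) 1,
      ∑ k, ‖(φ : StrongDual 𝕜 E) (x k)‖ ^ q) ≤ B ^ q := by
    have : Nonempty (Metric.closedBall (0 : StrongDual 𝕜 E) 1) := ⟨⟨0, by simp⟩⟩
    refine ciSup_le fun φ => ?_
    have h1 := Real.rpow_le_rpow (Real.rpow_nonneg (hnn φ) _) (h φ (mem_closedBall_zero_iff.1 φ.2)) hq.le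
    rwa [← Real.rpow_mul (hnn φ), one_div_mul_cancel hq.ne', Real.rpow_one] at h1
  calc weakNorm 𝕜 q x ≤ (B ^ q) ^ (1 / q) :=
        Real.rpow_le_rpow (Real.iSup_nonneg fun φ => hnn φ) this (one_div_pos.2 hq).le
    _ = B := by rw [← Real.rpow_mul hB, mul_one_div_cancel hq.ne', Real.rpow_one]

/-- Comparison of the weak `ℓ_s` and `ℓ_q` norms of a finite sequence. -/
theorem weakNorm_le_rpow_mul_weakNorm {q s : ℝ} (hq : 0 < q) (hs : 0 < s) {n : ℕ}
    (x : Fin n → E) :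
    weakNorm 𝕜 s x ≤ (n : ℝ) ^ max 0 (1 / s - 1 / q) * weakNorm 𝕜 q x := by
  refine weakNorm_le hs (mul_nonneg (by positivity) (weakNorm_nonneg _ _)) fun φ hφ => ?_
  have h := rpow_sum_rpow_le (a := fun k => ‖φ (x k)‖) (fun k => norm_nonneg _) hs hq
  rw [Fintype.card_fin] at h
  exact h.trans (mul_le_mul_of_nonneg_left (le_weakNorm hq x hφ) (by positivity))

/-- If `‖a_k‖ ≤ R_k ^ (1 - 1 / s)`, the norm of `∑ a_k x_k` is at most
`(∑ R_k) ^ (1 - 1 / s)` times the weak `ℓ_s` norm of `x`. -/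
theorem norm_sum_smul_le {s : ℝ} (hs : 1 ≤ s) {n : ℕ} (x : Fin n → E) {R : Fin n → ℝ}
    (hR : ∀ k, 0 ≤ R k) {a : Fin n → 𝕜} (ha : ∀ k, ‖a k‖ ≤ R k ^ (1 - 1 / s)) :
    ‖∑ k, a k • x k‖ ≤ (∑ k, R k) ^ (1 - 1 / s) * weakNorm 𝕜 s x := by
  obtain ⟨φ, hφ, hv⟩ := exists_dual_vector'' 𝕜 (∑ k, a k • x k)
  calc ‖∑ k, a k • x k‖ = ‖φ (∑ k, a k • x k)‖ := by rw [hv]; simp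
    _ ≤ ∑ k, ‖a k‖ * ‖φ (x k)‖ := by
        rw [map_sum]
        refine (norm_sum_le _ _).trans (le_of_eq ?_)
        simp
    _ ≤ ∑ k, R k ^ (1 - 1 / s) * ‖φ (x k)‖ :=
        Finset.sum_le_sum fun k _ => mul_le_mul_of_nonneg_right (ha k) (norm_nonneg _)
    _ ≤ (∑ k, R k) ^ (1 - 1 / s) * (∑ k, ‖φ (x k)‖ ^ s) ^ (1 / s) :=
        sum_rpow_mul_le hR (fun k => norm_nonneg _) hs
    _ ≤ _ := mul_le_mul_of_nonneg_left (le_weakNorm (by linarith) x hφ)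
        (Real.rpow_nonneg (Finset.sum_nonneg fun k _ => hR k) _)

end WeakNorm

/-! ### Cotype and its iteration over several indices -/

section Cotype

theorem abs_rademacher_le_one (k : ℕ) (t : ℝ) : |rademacher k t| ≤ 1 := by
  unfold rademacher
  rcases Real.sign_apply_eq (Real.sin ((2 : ℝ) ^ k * Real.pi * t)) with h | h | h <;> simp [h]

theorem measurable_rademacher (k : ℕ) : Measurable (rademacher k) := by
  have h : Measurable Real.sign := by
    unfold Real.sign
    exact Measurable.ite measurableSet_Iio measurable_const
      (Measurable.ite measurableSet_Ioi measurable_const measurable_const)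
  exact h.comp (by fun_prop)

variable {𝕜 : Type*} [RCLike 𝕜] {F : Type*} [NormedAddCommGroup F] [NormedSpace 𝕜 F]

theorem norm_rademacher_le_one (k : ℕ) (t : ℝ) : ‖((rademacher k t : ℝ) : 𝕜)‖ ≤ 1 := by
  rw [RCLike.norm_ofReal]; exact abs_rademacher_le_one k t

variable (𝕜) in
theorem integrable_norm_rademacher_sum_rpow {n : ℕ} (x : Fin n → F) {u : ℝ} (hu : 0 ≤ u) :
    Integrable (fun t => ‖∑ k : Fin n, ((rademacher ((k : ℕ) + 1) t : ℝ) : 𝕜) • x k‖ ^ u)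
      (volume.restrict (Set.Ioc (0 : ℝ) 1)) := by
  have hmeas : StronglyMeasurable
      (fun t => ∑ k : Fin n, ((rademacher ((k : ℕ) + 1) t : ℝ) : 𝕜) • x k) := by
    refine Finset.stronglyMeasurable_fun_sum _ fun k _ => ?_
    exact ((RCLike.measurable_ofReal.comp
      (measurable_rademacher ((k : ℕ) + 1))).stronglyMeasurable).smul_const (x k)
  refine Integrable.of_bound (C := (∑ k, ‖x k‖) ^ u)
    (hmeas.norm.measurable.pow_const u).aestronglyMeasurable (ae_of_all _ fun t => ?_)
  rw [Real.norm_of_nonneg (Real.rpow_nonneg (norm_nonneg _) _)]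
  refine Real.rpow_le_rpow (norm_nonneg _) ?_ hu
  refine norm_sum_le_of_le _ fun k _ => ?_
  rw [norm_smul]
  exact mul_le_of_le_one_left (norm_nonneg _) (norm_rademacher_le_one _ _)

theorem two_le_of_two_le_ofReal {r : ℝ} (h : 2 ≤ ENNReal.ofReal r) : 2 ≤ r := by
  by_contra hlt
  have : ENNReal.ofReal r < 2 := by
    rw [show (2 : ℝ≥0∞) = ENNReal.ofReal 2 by simp]
    exact (ENNReal.ofReal_lt_ofReal_iff (by norm_num)).2 (not_le.1 hlt)
  exact absurd h (not_le.2 this)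

/-- Cotype `r` with the `L_r` average of the Rademacher sums in place of the `L_2` average. -/
theorem HasCotype.exists_sum_rpow_le_integral {r : ℝ} (h : HasCotype 𝕜 F (ENNReal.ofReal r)) :
    2 ≤ r ∧ ∃ C : ℝ, 0 ≤ C ∧ ∀ (n : ℕ) (x : Fin n → F),
      ∑ k, ‖x k‖ ^ r ≤ C ^ r * ∫ t in Set.Ioc (0 : ℝ) 1,
        ‖∑ k : Fin n, ((rademacher ((k : ℕ) + 1) t : ℝ) : 𝕜) • x k‖ ^ r := by
  obtain ⟨h2, C, hC, hx⟩ := h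
  have h2r : 2 ≤ r := two_le_of_two_le_ofReal h2
  have hr0 : 0 < r := by linarith
  refine ⟨h2r, C, hC, fun n x => ?_⟩
  have h1 := hx n x
  have htr : (ENNReal.ofReal r).toReal = r := ENNReal.toReal_ofReal hr0.le
  rw [PiLp.norm_eq_sum (by rw [htr]; exact hr0), htr, intervalIntegral.integral_of_le zero_le_one]
    at h1
  set g : ℝ → ℝ := fun t => ‖∑ k : Fin n, ((rademacher ((k : ℕ) + 1) t : ℝ) : 𝕜) • x k‖ with hg
  have hg0 : ∀ t, 0 ≤ g t := fun t => norm_nonneg _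
  have hSn : 0 ≤ ∑ k, ‖x k‖ ^ r :=
    Finset.sum_nonneg fun _ _ => Real.rpow_nonneg (norm_nonneg _) _
  have hI : 0 ≤ ∫ t in Set.Ioc (0 : ℝ) 1, g t ^ 2 := integral_nonneg fun t => by positivity
  have h3 := Real.rpow_le_rpow (Real.rpow_nonneg hSn _) h1 hr0.le
  rw [← Real.rpow_mul hSn, one_div_mul_cancel hr0.ne', Real.rpow_one,
    Real.mul_rpow hC (Real.rpow_nonneg hI _), ← Real.rpow_mul hI] at h3
  refine h3.trans (mul_le_mul_of_nonneg_left ?_ (Real.rpow_nonneg hC _))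
  have : IsProbabilityMeasure (volume.restrict (Set.Ioc (0 : ℝ) 1)) := ⟨by simp⟩
  have hgi := integrable_norm_rademacher_sum_rpow 𝕜 x (u := 2) (by norm_num)
  simp only [Real.rpow_two] at hgi
  have e : ∀ t, (g t ^ 2) ^ (1 / 2 * r) = g t ^ r := fun t => by
    rw [← Real.rpow_two, ← Real.rpow_mul (hg0 t)]; congr 1; ring
  -- Jensen for `u ↦ u ^ (r / 2)`, convex since `r ≥ 2`. The exponent `r` on both sides is what
  -- later lets the integral commute with sums over the other indices.
  have hJ := (convexOn_rpow (p := 1 / 2 * r) (by linarith)).map_integral_le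
    (μ := volume.restrict (Set.Ioc (0 : ℝ) 1)) (f := fun t => g t ^ 2)
    (Real.continuous_rpow_const (by positivity)).continuousOn isClosed_Ici
    (ae_of_all _ fun t => Set.mem_Ici.2 (by positivity)) hgi
    (by
      simp only [Function.comp_def, e]
      exact integrable_norm_rademacher_sum_rpow 𝕜 x hr0.le)
  simpa only [e] using hJ

theorem sum_fin_succ_pi {V : Type*} [AddCommMonoid V] {m n : ℕ}
    (f : (Fin (m + 1) → Fin n) → V) :
    ∑ k, f k = ∑ k : Fin m → Fin n, ∑ j : Fin n, f (Fin.cons j k) := by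
  rw [← (Fin.consEquiv (fun _ : Fin (m + 1) => Fin n)).sum_comp, Fintype.sum_prod_type,
    Finset.sum_comm]
  rfl

/-- Iterated cotype inequality for families indexed by `m`-tuples. -/
theorem sum_rpow_le_of_forall_norm_sum_le {r C : ℝ} (hr : 0 < r) (hC : 0 ≤ C)
    (h : ∀ (n : ℕ) (x : Fin n → F), ∑ k, ‖x k‖ ^ r ≤ C ^ r * ∫ t in Set.Ioc (0 : ℝ) 1,
        ‖∑ k : Fin n, ((rademacher ((k : ℕ) + 1) t : ℝ) : 𝕜) • x k‖ ^ r) {n : ℕ} {M : ℝ} :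
    ∀ {m : ℕ} (y : (Fin m → Fin n) → F),
      (∀ a : Fin m → Fin n → 𝕜, (∀ i k, ‖a i k‖ ≤ 1) → ‖∑ k, (∏ i, a i (k i)) • y k‖ ≤ M) →
      ∑ k, ‖y k‖ ^ r ≤ (C ^ m * M) ^ r
  | 0, y, hy => by
    have := hy (fun i => i.elim0) (fun i => i.elim0)
    simp only [Finset.univ_unique, Finset.sum_singleton, Finset.univ_eq_empty, Finset.prod_empty,
      one_smul] at this ⊢
    rw [pow_zero, one_mul]
    exact Real.rpow_le_rpow (norm_nonneg _) this hr.le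
  | m + 1, y, hy => by
    have hM : 0 ≤ M := (norm_nonneg _).trans (hy (fun _ _ => 0) (by simp))
    have : IsProbabilityMeasure (volume.restrict (Set.Ioc (0 : ℝ) 1)) := ⟨by simp⟩
    set z : ℝ → (Fin m → Fin n) → F := fun t k =>
      ∑ j : Fin n, ((rademacher ((j : ℕ) + 1) t : ℝ) : 𝕜) • y (Fin.cons j k) with hz
    have hint : ∀ k, Integrable (fun t => ‖z t k‖ ^ r) (volume.restrict (Set.Ioc (0 : ℝ) 1)) :=
      fun k => integrable_norm_rademacher_sum_rpow 𝕜 _ hr.le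
    calc ∑ k, ‖y k‖ ^ r = ∑ k : Fin m → Fin n, ∑ j : Fin n, ‖y (Fin.cons j k)‖ ^ r := sum_fin_succ_pi _
      _ ≤ ∑ k : Fin m → Fin n, C ^ r * ∫ t in Set.Ioc (0 : ℝ) 1, ‖z t k‖ ^ r :=
          Finset.sum_le_sum fun k _ => h n _
      _ = C ^ r * ∫ t in Set.Ioc (0 : ℝ) 1, ∑ k, ‖z t k‖ ^ r := by
          rw [integral_finsetSum _ fun k _ => hint k, Finset.mul_sum]
      _ ≤ C ^ r * ∫ _t in Set.Ioc (0 : ℝ) 1, (C ^ m * M) ^ r := by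
          refine mul_le_mul_of_nonneg_left ?_ (Real.rpow_nonneg hC _)
          refine integral_mono (integrable_finsetSum _ fun k _ => hint k)
            (integrable_const _) fun t => ?_
          -- For fixed `t`, the Rademacher values act as the first family of coefficients in `hy`,
          -- so `z t` satisfies the hypothesis with the same `M`.
          refine sum_rpow_le_of_forall_norm_sum_le hr hC h (z t) fun a ha => ?_
          have := hy (Fin.cons (fun j => ((rademacher ((j : ℕ) + 1) t : ℝ) : 𝕜)) a) (fun i k => by
            refine Fin.cases ?_ (fun i => ?_) i
            · exact norm_rademacher_le_one _ _
            · exact ha i k)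
          rw [sum_fin_succ_pi] at this
          simp only [Fin.prod_univ_succ, Fin.cons_zero, Fin.cons_succ] at this
          convert this using 3 with k
          rw [hz, Finset.smul_sum]
          refine Finset.sum_congr rfl fun j _ => ?_
          rw [smul_smul, mul_comm]
      _ = (C ^ (m + 1) * M) ^ r := by
          rw [integral_const, probReal_univ, one_smul, ← Real.mul_rpow hC (by positivity)]
          congr 1; ring

end Cotype

/-! ### Multiple summing operators and the index -/

section Summing

variable {𝕜 : Type*} [RCLike 𝕜] {m : ℕ} {E : Fin m → Type*}
  [∀ i, NormedAddCommGroup (E i)] [∀ i, NormedSpace 𝕜 (E i)]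
  {F : Type*} [NormedAddCommGroup F] [NormedSpace 𝕜 F]

/-- If `F` has cotype `r`, every continuous `m`-linear operator into `F` is multiple
`(t, s)`-summing, where `1 / t = 1 / r - m * (1 - 1 / s)`. -/
theorem HasCotype.exists_multiple_summing {r s t : ℝ} (h : HasCotype 𝕜 F (ENNReal.ofReal r))
    (hs : 1 ≤ s) (ht : 0 < t) (hrst : 1 / t = 1 / r - m * (1 - 1 / s))
    (T : ContinuousMultilinearMap 𝕜 E F) :
    ∃ C : ℝ, 0 ≤ C ∧ ∀ (n : ℕ) (x : (i : Fin m) → Fin n → E i),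
      (∑ k : Fin m → Fin n, ‖T (fun i => x i (k i))‖ ^ t) ^ (1 / t) ≤
        C * ∏ i, weakNorm 𝕜 s (x i) := by
  obtain ⟨h2r, C, hC, hcot⟩ := h.exists_sum_rpow_le_integral
  have hr : 0 < r := by linarith
  refine ⟨C ^ m * ‖T‖, by positivity, fun n x => ?_⟩
  set e : ℝ := 1 - 1 / s with he
  have he0 : 0 ≤ e := by
    rw [he, sub_nonneg, div_le_one (by linarith)]; exact hs
  set v : (Fin m → Fin n) → F := fun k => T (fun i => x i (k i)) with hv
  have hvt : ∀ k, 0 ≤ ‖v k‖ ^ t := fun k => Real.rpow_nonneg (norm_nonneg _) _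
  set S : ℝ := ∑ k, ‖v k‖ ^ t with hS
  have hS0 : 0 ≤ S := Finset.sum_nonneg fun k _ => hvt k
  have hW0 : 0 ≤ ∏ i, weakNorm 𝕜 s (x i) := Finset.prod_nonneg fun i _ => weakNorm_nonneg _ _
  -- the marginals of `‖v k‖ ^ t`
  set R : Fin m → Fin n → ℝ := fun i j => ∑ k with k i = j, ‖v k‖ ^ t with hR
  have hR0 : ∀ i j, 0 ≤ R i j := fun i j => Finset.sum_nonneg fun k _ => hvt k
  have hRS : ∀ i, ∑ j, R i j = S := fun i =>
    Finset.sum_fiberwise Finset.univ (fun k : Fin m → Fin n => k i) (fun k => ‖v k‖ ^ t)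
  have hle : ∀ i k, ‖v k‖ ^ t ≤ R i (k i) := fun i k =>
    Finset.single_le_sum (f := fun k => ‖v k‖ ^ t) (fun k _ => hvt k) (by simp)
  -- By multilinearity the weights move inside `T`; each argument then has norm at most `S ^ e`
  -- times a weak `ℓ_s` norm, because every marginal sums to `S`.
  have hkey := sum_rpow_le_of_forall_norm_sum_le (𝕜 := 𝕜) hr hC hcot
    (M := ‖T‖ * ∏ i, (S ^ e * weakNorm 𝕜 s (x i)))
    (fun k : Fin m → Fin n => (∏ i, ((R i (k i) ^ e : ℝ) : 𝕜)) • v k) (fun a ha => by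
      have hexp : ∑ k : Fin m → Fin n,
          (∏ i, a i (k i)) • (∏ i, ((R i (k i) ^ e : ℝ) : 𝕜)) • v k =
            T (fun i => ∑ j, (a i j * ((R i j ^ e : ℝ) : 𝕜)) • x i j) := by
        rw [T.map_sum]
        refine Finset.sum_congr rfl fun k _ => ?_
        rw [T.map_smul_univ, smul_smul, Finset.prod_mul_distrib]
      rw [hexp]
      refine (T.le_opNorm _).trans (mul_le_mul_of_nonneg_left ?_ (norm_nonneg _))
      refine Finset.prod_le_prod (fun i _ => norm_nonneg _) fun i _ => ?_
      rw [← hRS i]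
      refine norm_sum_smul_le hs (x i) (hR0 i) fun j => ?_
      rw [norm_mul, RCLike.norm_ofReal, abs_of_nonneg (Real.rpow_nonneg (hR0 i j) _)]
      exact mul_le_of_le_one_left (Real.rpow_nonneg (hR0 i j) _) (ha i j))
  have hexp1 : r * (1 + t * e * m) = t := by
    have : (1 + t * e * m) / t = 1 / r := by
      rw [add_div, hrst]; field_simp; ring
    rw [div_eq_div_iff ht.ne' hr.ne'] at this
    linarith
  -- Each of the `m` weights at `k` is at least `‖v k‖ ^ (t * e)`, so the weighted term is at least
  -- `‖v k‖ ^ (r * (1 + t * e * m)) = ‖v k‖ ^ t`.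
  have hlow : S ≤ ∑ k : Fin m → Fin n, ‖(∏ i, ((R i (k i) ^ e : ℝ) : 𝕜)) • v k‖ ^ r := by
    refine Finset.sum_le_sum fun k _ => ?_
    have hn : ‖∏ i, ((R i (k i) ^ e : ℝ) : 𝕜)‖ = ∏ i, R i (k i) ^ e := by
      rw [norm_prod]
      refine Finset.prod_congr rfl fun i _ => ?_
      rw [RCLike.norm_ofReal, abs_of_nonneg (Real.rpow_nonneg (hR0 i _) _)]
    rw [norm_smul, hn]
    have h1 : ‖v k‖ ^ (t * e * m) ≤ ∏ i, R i (k i) ^ e := by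
      calc ‖v k‖ ^ (t * e * m) = ∏ _i : Fin m, (‖v k‖ ^ t) ^ e := by
            rw [Finset.prod_const, Finset.card_univ, Fintype.card_fin,
              ← Real.rpow_mul (norm_nonneg _), ← Real.rpow_natCast,
              ← Real.rpow_mul (norm_nonneg _)]
        _ ≤ _ := Finset.prod_le_prod (fun i _ => Real.rpow_nonneg (hvt k) _)
            fun i _ => Real.rpow_le_rpow (hvt k) (hle i k) he0
    have hq0 : 0 ≤ t * e * m := by positivity
    calc ‖v k‖ ^ t = (‖v k‖ ^ (t * e * m) * ‖v k‖) ^ r := by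
          rw [← Real.rpow_add_one' (norm_nonneg _) (by positivity),
            ← Real.rpow_mul (norm_nonneg _)]
          congr 1; linarith
      _ ≤ _ := Real.rpow_le_rpow (mul_nonneg (Real.rpow_nonneg (norm_nonneg _) _) (norm_nonneg _))
          (mul_le_mul_of_nonneg_right h1 (norm_nonneg _)) hr.le
  have hfin := hlow.trans hkey
  rw [Finset.prod_mul_distrib, Finset.prod_const, Finset.card_univ, Fintype.card_fin,
    ← Real.rpow_natCast (S ^ e), ← Real.rpow_mul hS0] at hfin
  -- The case `S = 0` is separate because the conclusion comes from cancelling `S ^ (e * m)`.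
  rcases hS0.eq_or_lt with h0 | hpos
  · rw [← h0, Real.zero_rpow (one_div_pos.2 ht).ne']
    positivity
  set W := ∏ i, weakNorm 𝕜 s (x i) with hW
  have h3 := Real.rpow_le_rpow hS0 hfin (one_div_pos.2 hr).le
  rw [← Real.rpow_mul (by positivity), mul_one_div_cancel hr.ne', Real.rpow_one] at h3
  have h4 : S ^ (1 / r) = S ^ (1 / t) * S ^ (e * m) := by
    rw [← Real.rpow_add hpos, hrst]; congr 1; ring
  rw [h4] at h3
  refine le_of_mul_le_mul_right ?_ (Real.rpow_pos_of_pos hpos (e * m))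
  calc _ ≤ _ := h3
    _ = _ := by ring

/-- An admissible exponent in terms of a cotype of `F`. -/
theorem HasCotype.mem_admissibleExponents {r s t p q : ℝ}
    (h : HasCotype 𝕜 F (ENNReal.ofReal r)) (hs : 1 ≤ s) (ht : 0 < t)
    (hrst : 1 / t = 1 / r - m * (1 - 1 / s)) (hp : 0 < p) (hq : 0 < q) :
    m * max 0 (1 / p - 1 / t) + m * max 0 (1 / s - 1 / q) ∈
      admissibleExponents 𝕜 E F p q := by
  refine ⟨by positivity, fun T => ?_⟩
  obtain ⟨C, hC, hT⟩ := h.exists_multiple_summing hs ht hrst T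
  refine ⟨C, hC, fun n hn x => ?_⟩
  have hn0 : (0 : ℝ) < n := by exact_mod_cast hn
  set α := max 0 (1 / p - 1 / t)
  set β := max 0 (1 / s - 1 / q)
  have h1 := rpow_sum_rpow_le (a := fun k : Fin m → Fin n => ‖T (fun i => x i (k i))‖)
    (fun k => norm_nonneg _) hp ht
  have hcard : ((Fintype.card (Fin m → Fin n) : ℕ) : ℝ) ^ α = (n : ℝ) ^ (m * α) := by
    rw [Fintype.card_fun, Fintype.card_fin, Fintype.card_fin, Nat.cast_pow, ← Real.rpow_natCast,
      ← Real.rpow_mul hn0.le]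
  rw [hcard] at h1
  have h2 : ∏ i, weakNorm 𝕜 s (x i) ≤ (n : ℝ) ^ (m * β) * ∏ i, weakNorm 𝕜 q (x i) := by
    calc ∏ i, weakNorm 𝕜 s (x i) ≤ ∏ i, ((n : ℝ) ^ β * weakNorm 𝕜 q (x i)) :=
          Finset.prod_le_prod (fun i _ => weakNorm_nonneg _ _) fun i _ =>
            weakNorm_le_rpow_mul_weakNorm hq (by linarith) (x i)
      _ = _ := by
          rw [Finset.prod_mul_distrib, Finset.prod_const, Finset.card_univ, Fintype.card_fin,
            ← Real.rpow_natCast, ← Real.rpow_mul hn0.le, mul_comm β]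
  calc _ ≤ _ := h1
    _ ≤ (n : ℝ) ^ (m * α) * (C * ((n : ℝ) ^ (m * β) * ∏ i, weakNorm 𝕜 q (x i))) := by
        refine mul_le_mul_of_nonneg_left ((hT n x).trans ?_) (by positivity)
        exact mul_le_mul_of_nonneg_left h2 hC
    _ = _ := by rw [Real.rpow_add hn0]; ring

theorem multIndex_nonneg (p q : ℝ) : 0 ≤ multIndex 𝕜 E F p q := by
  refine le_sInf ?_
  rintro _ ⟨σ, hσ, rfl⟩
  exact EReal.coe_nonneg.2 hσ.1

theorem two_le_of_cot_eq {r : ℝ} (hr : cot 𝕜 F = ENNReal.ofReal r) : 2 ≤ r :=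
  two_le_of_two_le_ofReal (hr ▸ le_sInf fun _ hq => hq.1)

theorem exists_hasCotype_lt_of_cot_eq {r : ℝ} (hr : cot 𝕜 F = ENNReal.ofReal r) {b : ℝ}
    (hb : r < b) : ∃ r', r ≤ r' ∧ r' < b ∧ HasCotype 𝕜 F (ENNReal.ofReal r') := by
  have h2 := two_le_of_cot_eq hr
  have hlt : sInf {q : ℝ≥0∞ | HasCotype 𝕜 F q} < ENNReal.ofReal b := by
    change cot 𝕜 F < _
    rw [hr]; exact (ENNReal.ofReal_lt_ofReal_iff (by linarith)).2 hb
  obtain ⟨c, hc, hcb⟩ := sInf_lt_iff.1 hlt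
  have hct : c ≠ ⊤ := (hcb.trans ENNReal.ofReal_lt_top).ne
  refine ⟨c.toReal, ?_, ?_, by rwa [ENNReal.ofReal_toReal hct]⟩
  · refine (ENNReal.ofReal_le_iff_le_toReal hct).1 ?_
    rw [← hr]; exact sInf_le hc
  · exact (ENNReal.lt_ofReal_iff_toReal_lt hct).1 hcb

/-- The upper bound for the index in terms of `cot F`. -/
theorem multIndex_le_of_cot_eq {r s t p q : ℝ} (hr : cot 𝕜 F = ENNReal.ofReal r) (hs : 1 ≤ s)
    (ht : 0 < t) (hrst : 1 / t = 1 / r - m * (1 - 1 / s)) (hp : 0 < p) (hq : 0 < q) :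
    multIndex 𝕜 E F p q ≤
      ((m * max 0 (1 / p - 1 / t) + m * max 0 (1 / s - 1 / q) : ℝ) : EReal) := by
  have h2 := two_le_of_cot_eq hr
  set D : ℝ := m * (1 - 1 / s) with hD
  have hD0 : 0 < 1 / r - D := hrst ▸ one_div_pos.2 ht
  have hcont : ContinuousAt (fun u : ℝ => 1 / u - D) r := by
    simp only [one_div]
    exact (continuousAt_inv₀ (by linarith)).sub continuousAt_const
  set f : ℝ → ℝ := fun u => m * max 0 (1 / p - (1 / u - D)) + m * max 0 (1 / s - 1 / q) with hf
  have hfc : ContinuousAt f r :=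
    ((continuousAt_const.max (continuousAt_const.sub hcont)).const_mul _).add continuousAt_const
  rw [hrst]
  refine le_of_forall_gt_imp_ge_of_dense fun a ha => ?_
  have hev : ∀ᶠ u in 𝓝 r, (f u : EReal) < a ∧ 0 < 1 / u - D :=
    ((continuous_coe_real_ereal.continuousAt.comp hfc).eventually_lt_const ha).and
      (hcont.eventually_const_lt hD0)
  obtain ⟨ε, hε, hball⟩ := Metric.eventually_nhds_iff.1 hev
  obtain ⟨r', hrr', hr'b, hcot⟩ := exists_hasCotype_lt_of_cot_eq hr (b := r + ε) (by linarith)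
  obtain ⟨h3, h4⟩ := hball (y := r') (by
    rw [Real.dist_eq, abs_of_nonneg (by linarith)]; linarith)
  refine le_trans (sInf_le ⟨f r', ?_, rfl⟩) h3.le
  -- With `s` kept fixed, cotype `r'` determines its own summing exponent through `1 / t' = 1 / r' -
  -- D`, positive for `r'` near `r`.
  have := hcot.mem_admissibleExponents (E := E) (t := 1 / (1 / r' - D)) hs (one_div_pos.2 h4)
    (by rw [one_div_one_div]) hp hq
  rwa [one_div_one_div] at this

end Summing

end MultIndex

/-! ### The four cases -/

theorem mainTheorem6 {𝕜 : Type*} [RCLike 𝕜] (m : ℕ) (hm : 1 ≤ m) (E : Fin m → Type*)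
    [∀ i, NormedAddCommGroup (E i)] [∀ i, NormedSpace 𝕜 (E i)] [∀ i, CompleteSpace (E i)]
    (F : Type*) [NormedAddCommGroup F] [NormedSpace 𝕜 F] [CompleteSpace F]
    (hE : ∀ i, ¬ FiniteDimensional 𝕜 (E i)) (hF : ¬ FiniteDimensional 𝕜 F)
    (r : ℝ) (hr : MultIndex.cot 𝕜 F = ENNReal.ofReal r)
    (s : ℝ) (hs1 : 1 ≤ s) (hs2 : s < 2)
    -- the condition `m < s / (r * (s - 1))`, which is void for `s = 1`
    (hms : s = 1 ∨ (m : ℝ) < s / (r * (s - 1)))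
    (t : ℝ) (ht : t = s * r / (s - m * s * r + m * r)) :
    (∀ p q : ℝ, 0 < p → p ≤ t → m * r * t / (r - t + m * r * t) ≤ q →
      MultIndex.multIndex 𝕜 E F p q ≤
        ((m / p + m - 1 / r - m / q - (m - 1) / t : ℝ) : EReal)) ∧
    (∀ p q : ℝ, 0 < p → p ≤ t → 0 < q → q ≤ m * r * t / (r - t + m * r * t) →
      MultIndex.multIndex 𝕜 E F p q ≤ ((m / p - m / t : ℝ) : EReal)) ∧
    (∀ p q : ℝ, 0 < t → t ≤ p → m * r * t / (r - t + m * r * t) ≤ q →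
      MultIndex.multIndex 𝕜 E F p q ≤ ((m - 1 / r + 1 / t - m / q : ℝ) : EReal)) ∧
    (∀ p q : ℝ, 0 < t → t ≤ p → 0 < q → q ≤ m * r * t / (r - t + m * r * t) →
      MultIndex.multIndex 𝕜 E F p q = 0) := by
  have h2 : 2 ≤ r := MultIndex.two_le_of_cot_eq hr
  have hr0 : 0 < r := by linarith
  have hs0 : 0 < s := by linarith
  have hm0 : (0 : ℝ) < m := by exact_mod_cast hm
  -- The restriction on `m` says exactly that this denominator is positive, i.e. that `1 / t > 0`.
  have hden : 0 < s - m * s * r + m * r := by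
    rcases hs1.eq_or_lt with rfl | h1
    · nlinarith
    rcases hms with rfl | hms
    · nlinarith
    have h3 : 0 < r * (s - 1) := mul_pos hr0 (by linarith)
    rw [lt_div_iff₀ h3] at hms
    linarith
  have ht0 : 0 < t := ht ▸ div_pos (mul_pos hs0 hr0) hden
  have hrst : 1 / t = 1 / r - m * (1 - 1 / s) := by
    rw [ht]; field_simp; ring
  -- The critical value of `q` is `s` itself, since `m / s = m - 1 / r + 1 / t`.
  have hcrit : m * r * t / (r - t + m * r * t) = s := by
    have hd : r - t + m * r * t = m * r * t / s := by
      have h3 : m * (1 / s) = m - 1 / r + 1 / t := by rw [hrst]; ring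
      calc r - t + m * r * t = r * t * (m - 1 / r + 1 / t) := by field_simp; ring
        _ = r * t * (m * (1 / s)) := by rw [h3]
        _ = _ := by ring
    rw [hd]
    field_simp
  rw [hcrit]
  have key : ∀ p q : ℝ, 0 < p → 0 < q → MultIndex.multIndex 𝕜 E F p q ≤
      ((m * max 0 (1 / p - 1 / t) + m * max 0 (1 / s - 1 / q) : ℝ) : EReal) :=
    fun p q hp hq => MultIndex.multIndex_le_of_cot_eq hr hs1 ht0 hrst hp hq
  have hmax : ∀ {a b : ℝ}, 0 < a → a ≤ b →
      max 0 (1 / a - 1 / b) = 1 / a - 1 / b ∧ max 0 (1 / b - 1 / a) = 0 := fun ha hab => by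
    have := one_div_le_one_div_of_le ha hab
    exact ⟨max_eq_right (by linarith), max_eq_left (by linarith)⟩
  refine ⟨fun p q hp hpt hsq => ?_, fun p q hp hpt hq hqs => ?_, fun p q _ htp hsq => ?_,
    fun p q _ htp hq hqs => ?_⟩
  · have h := key p q hp (by linarith)
    rw [(hmax hp hpt).1, (hmax hs0 hsq).1] at h
    convert h using 2
    linear_combination hrst
  · have h := key p q hp hq
    rw [(hmax hp hpt).1, (hmax hq hqs).2] at h
    convert h using 2
    ring
  · have h := key p q (by linarith) (by linarith)
    rw [(hmax ht0 htp).2, (hmax hs0 hsq).1] at h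
    convert h using 2
    linear_combination hrst
  · have h := key p q (by linarith) hq
    rw [(hmax ht0 htp).2, (hmax hq hqs).2] at h
    refine le_antisymm ?_ (MultIndex.multIndex_nonneg p q)
    simpa using h
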